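/- Let $\mathcal{E}$ be a complex Hilbert space (not necessarily separable). Let $L^2_{\mathcal{E}}(\mathbb{T})$ be the Hilbert space of square-integrable $\mathcal{E}$-valued functions on the unit circle with normalized Lebesgue measure, and identify the Hardy space $H^2_{\mathcal{E}}(\mathbb{D})$, via radial limits, with the closed subspace of all $f \in L^2_{\mathcal{E}}(\mathbb{T})$ whose Fourier coefficients $\frac{1}{2\pi}\int_0^{2\pi} f(e^{i\theta}) e^{-in\theta}\,d\theta$ vanish for all $n<0$. Let $P$ be the orthogonal projection of $L^2_{\mathcal{E}}(\mathbb{T})$ onto $H^2_{\mathcal{E}}(\mathbb{D})$, and let $T_z$ be the operator of multiplication by $z$ on $H^2_{\mathcal{E}}(\mathbb{D})$. Let $L^\infty_{\mathcal{B}(\mathcal{E})}(\mathbb{T})$ be the set of essentially bounded functions $\Phi : \mathbb{T} \to \mathcal{B}(\mathcal{E})$ that are measurable in the strong operator sense (that is, $\Phi(\cdot)\eta$ is a strongly measurable $\mathcal{E}$-valued function for every $\eta \in \mathcal{E}$, up to modification on a null set that may depend on $\eta$), and for such $\Phi$ let $M_\Phi$ be the operator on $L^2_{\mathcal{E}}(\mathbb{T})$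 given by $(M_\Phi f)(e^{i\theta}) = \Phi(e^{i\theta}) f(e^{i\theta})$. Let $T$ be a bounded linear operator on $H^2_{\mathcal{E}}(\mathbb{D})$. Then $T$ is a Toeplitz operator, i.e. there exists $\Phi \in L^\infty_{\mathcal{B}(\mathcal{E})}(\mathbb{T})$ with $T = P M_\Phi|_{H^2_{\mathcal{E}}(\mathbb{D})}$, if and only if $T_z^* T T_z = T$. -/

import Mathlib

open MeasureTheory AddCircle

noncomputable section

namespace HardyToeplitz

/-- The length `2π` of the circle is positive. -/
instance factTwoPiPos : Fact (0 < 2 * Real.pi) := ⟨Real.two_pi_pos⟩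

/-- The unit circle `𝕋`, parametrized by the angle `θ ∈ ℝ / 2πℤ` (the point is `e^{iθ}`);
`fourier n` is then the function `θ ↦ e^{inθ}`. -/
abbrev Torus : Type := AddCircle (2 * Real.pi)

/-- Normalized Lebesgue measure on the circle. -/
abbrev normMeasure : Measure Torus := haarAddCircle

section Spaces

variable (E : Type*) [NormedAddCommGroup E] [InnerProductSpace ℂ E]

/-- The Hilbert space `L²_E(𝕋)`. -/
abbrev L2 : Type _ := Lp E 2 normMeasure

variable {E}

theorem integrable_fourier_smul (n : ℤ) (f : L2 E) :
    Integrable (fun θ => fourier n θ • f θ) normMeasure := by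
  have hf : Integrable (f : Torus → E) normMeasure :=
    (Lp.memLp f).integrable (by norm_num)
  refine hf.bdd_smul 1 (fourier n).continuous.aestronglyMeasurable ?_
  exact Filter.Eventually.of_forall fun θ => by
    rw [fourier_apply, Circle.norm_coe]

/-- The Hardy space `H²_E(𝔻)`, identified through radial limits with the subspace of `L²_E(𝕋)` of
all `f` whose Fourier coefficients `(1/2π) ∫ f(θ) e^{-inθ} dθ` vanish for every `n < 0`. -/
def hardy (E : Type*) [NormedAddCommGroup E] [InnerProductSpace ℂ E] : Submodule ℂ (L2 E) where
  carrier := {f | ∀ n : ℤ, n < 0 → fourierCoeff (f : Torus → E) n = 0}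
  zero_mem' := by
    intro n _
    have h : (fun θ => fourier (-n) θ • ((0 : L2 E) : Torus → E) θ) =ᵐ[normMeasure] 0 := by
      filter_upwards [Lp.coeFn_zero E 2 normMeasure] with θ h
      rw [h, Pi.zero_apply, smul_zero]
    exact (integral_congr_ae h).trans (by simp)
  add_mem' := by
    intro f g hf hg n hn
    have h : (fun θ => fourier (-n) θ • ((f + g : L2 E) : Torus → E) θ) =ᵐ[normMeasure]
        fun θ => fourier (-n) θ • f θ + fourier (-n) θ • g θ := by
      filter_upwards [Lp.coeFn_add f g] with θ h
      rw [h, Pi.add_apply, smul_add]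
    refine (integral_congr_ae h).trans ?_
    rw [integral_add (integrable_fourier_smul _ f) (integrable_fourier_smul _ g)]
    have h1 := hf n hn
    have h2 := hg n hn
    rw [fourierCoeff] at h1 h2
    rw [h1, h2, add_zero]
  smul_mem' := by
    intro c f hf n hn
    have h : (fun θ => fourier (-n) θ • ((c • f : L2 E) : Torus → E) θ) =ᵐ[normMeasure]
        fun θ => c • (fourier (-n) θ • f θ) := by
      filter_upwards [Lp.coeFn_smul c f] with θ h
      rw [h, Pi.smul_apply, smul_comm]
    refine (integral_congr_ae h).trans ?_
    rw [integral_smul]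
    have h1 := hf n hn
    rw [fourierCoeff] at h1
    rw [h1, smul_zero]

theorem mem_hardy {f : L2 E} :
    f ∈ hardy E ↔ ∀ n : ℤ, n < 0 → fourierCoeff (f : Torus → E) n = 0 := Iff.rfl

theorem norm_fourierCoeff_sub_le (n : ℤ) (f g : L2 E) :
    ‖fourierCoeff (f : Torus → E) n - fourierCoeff (g : Torus → E) n‖ ≤ ‖f - g‖ := by
  have hi : Integrable ((f - g : L2 E) : Torus → E) normMeasure :=
    (Lp.memLp (f - g)).integrable (by norm_num)
  have h : fourierCoeff (f : Torus → E) n - fourierCoeff (g : Torus → E) n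
      = ∫ θ, fourier (-n) θ • ((f - g : L2 E) : Torus → E) θ ∂normMeasure := by
    rw [fourierCoeff, fourierCoeff,
      ← integral_sub (integrable_fourier_smul _ f) (integrable_fourier_smul _ g)]
    refine integral_congr_ae ?_
    filter_upwards [Lp.coeFn_sub f g] with θ h
    rw [h, Pi.sub_apply, smul_sub]
  rw [h]
  refine (norm_integral_le_integral_norm _).trans ?_
  have h2 : ∀ θ : Torus, ‖fourier (-n) θ • ((f - g : L2 E) : Torus → E) θ‖
      = ‖((f - g : L2 E) : Torus → E) θ‖ := fun θ => by
    rw [norm_smul, fourier_apply, Circle.norm_coe, one_mul]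
  simp_rw [h2]
  rw [integral_norm_eq_lintegral_enorm hi.1, ← eLpNorm_one_eq_lintegral_enorm, Lp.norm_def]
  exact ENNReal.toReal_mono (Lp.eLpNorm_ne_top _)
    (eLpNorm_le_eLpNorm_of_exponent_le (by norm_num) hi.1)

theorem isClosed_hardy : IsClosed (hardy E : Set (L2 E)) := by
  have h : (hardy E : Set (L2 E))
      = ⋂ (n : ℤ) (_ : n < 0), {f : L2 E | fourierCoeff (f : Torus → E) n = 0} := by
    ext f
    simp [mem_hardy]
  rw [h]
  refine isClosed_iInter fun n => isClosed_iInter fun _ => ?_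
  refine isClosed_eq (LipschitzWith.continuous (K := 1) ?_) continuous_const
  refine LipschitzWith.of_dist_le_mul fun f g => ?_
  rw [dist_eq_norm, dist_eq_norm, NNReal.coe_one, one_mul]
  exact norm_fourierCoeff_sub_le n f g

instance completeSpaceHardy [CompleteSpace E] : CompleteSpace (hardy E) :=
  isClosed_hardy.completeSpace_coe

/-- (Representatives of) elements of `L^∞_{B(E)}(𝕋)`: essentially bounded functions
`Φ : 𝕋 → B(E)` that are measurable in the strong operator sense, i.e. `θ ↦ Φ(θ) η` is measurable
as an `E`-valued function for every `η ∈ E`. (For separable `E` this is the same as weak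
measurability. Measurability for the operator norm is not required.) -/
structure IsLInfty (Φ : Torus → E →L[ℂ] E) : Prop where
  measurable : ∀ η : E, AEStronglyMeasurable (fun θ => Φ θ η) normMeasure
  bounded : ∃ C : ℝ, ∀ᵐ θ ∂normMeasure, ‖Φ θ‖ ≤ C

theorem IsLInfty.aestronglyMeasurable_apply {Φ : Torus → E →L[ℂ] E} (hΦ : IsLInfty Φ)
    {f : Torus → E} (hf : AEStronglyMeasurable f normMeasure) :
    AEStronglyMeasurable (fun θ => Φ θ (f θ)) normMeasure := by
  obtain ⟨g, hg, hfg⟩ := hf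
  have key : AEStronglyMeasurable (fun θ => Φ θ (g θ)) normMeasure := by
    refine aestronglyMeasurable_of_tendsto_ae (u := Filter.atTop)
      (f := fun k θ => Φ θ (hg.approx k θ)) (fun k => ?_)
      (Filter.Eventually.of_forall fun θ => ((Φ θ).continuous.tendsto _).comp (hg.tendsto_approx θ))
    generalize hg.approx k = s
    have hs : (fun θ => Φ θ (s θ))
        = fun θ => ∑ y ∈ s.range, (s ⁻¹' {y}).indicator (fun θ => Φ θ y) θ := by
      funext θ
      rw [Finset.sum_eq_single (s θ)]
      · simp
      · intro y _ hy
        exact Set.indicator_of_notMem (fun h => hy (by simpa using h.symm)) _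
      · intro h
        exact absurd (SimpleFunc.mem_range_self s θ) h
    rw [hs]
    exact Finset.aestronglyMeasurable_fun_sum _ fun y _ =>
      (hΦ.measurable y).indicator (s.measurableSet_fiber y)
  refine key.congr ?_
  filter_upwards [hfg] with θ h
  rw [h]

theorem IsLInfty.memLp_apply {Φ : Torus → E →L[ℂ] E} (hΦ : IsLInfty Φ) (f : L2 E) :
    MemLp (fun θ => Φ θ (f θ)) 2 normMeasure := by
  obtain ⟨C, hC⟩ := hΦ.bounded
  refine (Lp.memLp f).of_le_mul (c := C) (hΦ.aestronglyMeasurable_apply (Lp.aestronglyMeasurable f)) ?_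
  filter_upwards [hC] with θ h
  exact (Φ θ).le_of_opNorm_le h _

/-- The Laurent operator `M_Φ` on `L²_E(𝕋)`: `(M_Φ f)(θ) = Φ(θ) f(θ)`. -/
def laurent (Φ : Torus → E →L[ℂ] E) (hΦ : IsLInfty Φ) : L2 E →L[ℂ] L2 E :=
  LinearMap.mkContinuousOfExistsBound
    { toFun := fun f => (hΦ.memLp_apply f).toLp _
      map_add' := fun f g => by
        rw [← MemLp.toLp_add]
        refine MemLp.toLp_congr _ _ ?_
        filter_upwards [Lp.coeFn_add f g] with θ h
        rw [h, Pi.add_apply, Pi.add_apply, map_add]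
      map_smul' := fun c f => by
        rw [RingHom.id_apply, ← MemLp.toLp_const_smul]
        refine MemLp.toLp_congr _ _ ?_
        filter_upwards [Lp.coeFn_smul c f] with θ h
        rw [h, Pi.smul_apply, Pi.smul_apply, map_smul] }
    (by
      obtain ⟨C, hC⟩ := hΦ.bounded
      refine ⟨C, fun f => Lp.norm_le_mul_norm_of_ae_le_mul ?_⟩
      filter_upwards [hC, (hΦ.memLp_apply f).coeFn_toLp] with θ h h'
      rw [LinearMap.coe_mk, AddHom.coe_mk, h']
      exact (Φ θ).le_of_opNorm_le h _)

theorem laurent_coeFn (Φ : Torus → E →L[ℂ] E) (hΦ : IsLInfty Φ) (f : L2 E) :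
    (laurent Φ hΦ f : Torus → E) =ᵐ[normMeasure] fun θ => Φ θ (f θ) :=
  (hΦ.memLp_apply f).coeFn_toLp

/-- The symbol `θ ↦ e^{iθ} I_E`. -/
def zSymbol (E : Type*) [NormedAddCommGroup E] [InnerProductSpace ℂ E] : Torus → E →L[ℂ] E :=
  fun θ => (fourier 1 θ : ℂ) • ContinuousLinearMap.id ℂ E

theorem isLInfty_zSymbol : IsLInfty (zSymbol E) where
  measurable η := by
    have h : Continuous fun θ : Torus => zSymbol E θ η :=
      (fourier 1).continuous.smul continuous_const
    exact h.aestronglyMeasurable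
  bounded := ⟨1, Filter.Eventually.of_forall fun θ => by
    rw [zSymbol, norm_smul, fourier_apply, Circle.norm_coe, one_mul]
    exact ContinuousLinearMap.norm_id_le⟩

theorem laurent_zSymbol_mem (f : L2 E) (hf : f ∈ hardy E) :
    laurent (zSymbol E) isLInfty_zSymbol f ∈ hardy E := by
  intro n hn
  rw [← hf (n - 1) (by omega), fourierCoeff, fourierCoeff]
  refine integral_congr_ae ?_
  filter_upwards [laurent_coeFn (zSymbol E) isLInfty_zSymbol f] with θ h
  have h1 : (-(n - 1) : ℤ) = -n + 1 := by ring
  rw [h, h1, fourier_add, mul_smul]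
  rfl

/-- The shift `T_z` on `H²_E(𝔻)`: multiplication by the coordinate function `z`, that is, by
`e^{iθ}` on the circle. -/
def Tz (E : Type*) [NormedAddCommGroup E] [InnerProductSpace ℂ E] : hardy E →L[ℂ] hardy E :=
  ((laurent (zSymbol E) isLInfty_zSymbol).comp (hardy E).subtypeL).codRestrict (hardy E)
    fun f => laurent_zSymbol_mem (f : L2 E) f.2

/-- `T` is a Toeplitz operator: `T = P M_Φ |_{H²_E(𝔻)}` for some `Φ ∈ L^∞_{B(E)}(𝕋)`, where `P` is
the orthogonal projection of `L²_E(𝕋)` onto `H²_E(𝔻)`. -/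
def IsToeplitz [CompleteSpace E] (T : hardy E →L[ℂ] hardy E) : Prop :=
  ∃ (Φ : Torus → E →L[ℂ] E) (hΦ : IsLInfty Φ),
    T = (hardy E).orthogonalProjectionOnto ∘L laurent Φ hΦ ∘L (hardy E).subtypeL

end Spaces

end HardyToeplitz

end

noncomputable section

namespace HardyToeplitz

open scoped InnerProductSpace Topology ENNReal
open Filter

/-! Write `U` for multiplication by `z` on `L²`, a unitary. If `T` is the compression of `M_Φ`, the
relation holds because `M_Φ` commutes with `U` and `U` preserves inner products.

Conversely, the operators `S n = U⁻ⁿ T P Uⁿ` are bounded by `‖T‖`, and the relation says that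
shifting both arguments does not change the form of `T`. Hence any weak-operator limit `A` of `S n`
commutes with `U` and compresses to `T` (`exists_dilation`).

It remains to see that `A` is some `M_Φ` (`exists_laurent_eq`). One wants `Φ θ η = A(1·η)(θ)`, but
this is defined only off a null set depending on `η`, and `E` may be nonseparable. So `Φ θ` is built
at every `θ` as an ultrafilter weak limit of normalized compressions of `A` to shrinking balls,
which gives linearity and the bound `‖A‖` everywhere. Lebesgue differentiation then identifies it
with `A(1·η)` almost everywhere, separately for each `η`. -/

/-- A norm-bounded family of operators on a Hilbert space converges along every ultrafilter in the
weak operator topology. -/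
theorem exists_weakOperator_lim {ι K : Type*} [NormedAddCommGroup K] [InnerProductSpace ℂ K]
    [CompleteSpace K] (F : Ultrafilter ι) (S : ι → K →L[ℂ] K) (C : ℝ) (hS : ∀ i, ‖S i‖ ≤ C) :
    ∃ A : K →L[ℂ] K, ‖A‖ ≤ C ∧
      ∀ f g, Tendsto (fun i => ⟪g, S i f⟫_ℂ) F (𝓝 ⟪g, A f⟫_ℂ) := by
  have hC : 0 ≤ C := by
    obtain ⟨i⟩ := F.nonempty_of_mem univ_mem
    exact (norm_nonneg _).trans (hS i)
  have hb (i : ι) (f g : K) : ‖⟪S i f, g⟫_ℂ‖ ≤ C * ‖f‖ * ‖g‖ :=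
    (norm_inner_le_norm _ _).trans
      (mul_le_mul_of_nonneg_right ((S i).le_of_opNorm_le (hS i) f) (norm_nonneg g))
  have hlim (f g : K) : ∃ z : ℂ, ‖z‖ ≤ C * ‖f‖ * ‖g‖ ∧
      Tendsto (fun i => ⟪S i f, g⟫_ℂ) F (𝓝 z) := by
    have hK := isCompact_closedBall (0 : ℂ) (C * ‖f‖ * ‖g‖)
    obtain ⟨z, hz, hF⟩ := hK.ultrafilter_le_nhds (F.map fun i => ⟪S i f, g⟫_ℂ) (by
      rw [le_principal_iff]
      refine Filter.mem_map.mpr (univ_mem' fun i => ?_)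
      simpa using hb i f g)
    exact ⟨z, by simpa using hz, hF⟩
  choose b hbn hbt using hlim
  -- The limits form a bounded sesquilinear form, which Riesz representation turns into an operator.
  -- Putting `S i f` in the first slot gives the conjugate-linearity in `f` needed here; the last
  -- step conjugates back.
  let B : K →L⋆[ℂ] K →L[ℂ] ℂ := LinearMap.mkContinuous₂
    (LinearMap.mk₂'ₛₗ (starRingEnd ℂ) (RingHom.id ℂ) b
      (fun f f' g => tendsto_nhds_unique (hbt _ _) (by
        simpa only [map_add, inner_add_left] using (hbt f g).add (hbt f' g)))
      (fun c f g => tendsto_nhds_unique (hbt _ _) (by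
        simpa only [map_smul, inner_smul_left, smul_eq_mul] using
          (hbt f g).const_mul (starRingEnd ℂ c)))
      (fun f g g' => tendsto_nhds_unique (hbt _ _) (by
        simpa only [inner_add_right] using (hbt f g).add (hbt f g')))
      (fun c f g => tendsto_nhds_unique (hbt _ _) (by
        simpa only [inner_smul_right, smul_eq_mul, RingHom.id_apply] using
          (hbt f g).const_mul c)))
    C hbn
  have hB (f g : K) : ⟪InnerProductSpace.continuousLinearMapOfBilin B f, g⟫_ℂ = b f g :=
    InnerProductSpace.continuousLinearMapOfBilin_apply B f g
  refine ⟨InnerProductSpace.continuousLinearMapOfBilin B, ?_, fun f g => ?_⟩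
  · refine ContinuousLinearMap.opNorm_le_bound _ hC fun f => ?_
    set v := InnerProductSpace.continuousLinearMapOfBilin B f
    have h1 : ‖v‖ * ‖v‖ ≤ C * ‖f‖ * ‖v‖ := by
      calc ‖v‖ * ‖v‖ = ‖⟪v, v⟫_ℂ‖ := by
            rw [inner_self_eq_norm_sq_to_K, norm_pow, RCLike.norm_ofReal, abs_norm, sq]
        _ ≤ C * ‖f‖ * ‖v‖ := by rw [hB]; exact hbn f v
    rcases (norm_nonneg v).eq_or_lt with h0 | h0
    · rw [← h0]; positivity
    · exact le_of_mul_le_mul_right h1 h0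
  · have h := (Complex.continuous_conj.tendsto _).comp (hbt f g)
    rw [← hB, inner_conj_symm] at h
    refine h.congr fun i => ?_
    simp only [Function.comp_apply, inner_conj_symm]

/-! ### Multiplication by characters -/

variable {E : Type*} [NormedAddCommGroup E] [InnerProductSpace ℂ E]

theorem isLInfty_fourier_smul_id (n : ℤ) :
    IsLInfty fun θ : Torus => fourier n θ • ContinuousLinearMap.id ℂ E where
  measurable η := by
    have h : Continuous fun θ : Torus => fourier n θ • η :=
      (fourier n).continuous.smul continuous_const
    exact h.aestronglyMeasurable
  bounded := ⟨1, Eventually.of_forall fun θ => by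
    rw [norm_smul, fourier_apply, Circle.norm_coe, one_mul]
    exact ContinuousLinearMap.norm_id_le⟩

/-- Multiplication by `e^{inθ}` on `L²_E(𝕋)`. -/
def fourierMul (n : ℤ) : L2 E →L[ℂ] L2 E :=
  laurent (fun θ => fourier n θ • ContinuousLinearMap.id ℂ E) (isLInfty_fourier_smul_id n)

theorem fourierMul_coeFn (n : ℤ) (f : L2 E) :
    (fourierMul n f : Torus → E) =ᵐ[normMeasure] fun θ => fourier n θ • f θ :=
  laurent_coeFn _ (isLInfty_fourier_smul_id n) f

theorem coe_Tz_apply (f : hardy E) : (Tz E f : L2 E) = fourierMul 1 (f : L2 E) := rfl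

theorem fourierMul_zero (f : L2 E) : fourierMul 0 f = f := by
  refine Lp.ext ?_
  filter_upwards [fourierMul_coeFn 0 f] with θ h
  rw [h, fourier_zero, one_smul]

theorem fourierMul_fourierMul (m n : ℤ) (f : L2 E) :
    fourierMul m (fourierMul n f) = fourierMul (m + n) f := by
  refine Lp.ext ?_
  filter_upwards [fourierMul_coeFn m (fourierMul n f), fourierMul_coeFn n f,
    fourierMul_coeFn (m + n) f] with θ h1 h2 h3
  rw [h1, h2, h3, fourier_add, mul_smul]

theorem inner_fourierMul_left (n : ℤ) (f g : L2 E) :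
    ⟪fourierMul n f, g⟫_ℂ = ⟪f, fourierMul (-n) g⟫_ℂ := by
  rw [L2.inner_def, L2.inner_def]
  refine integral_congr_ae ?_
  filter_upwards [fourierMul_coeFn n f, fourierMul_coeFn (-n) g] with θ h1 h2
  rw [h1, h2, inner_smul_left, inner_smul_right, fourier_neg]

theorem inner_fourierMul_fourierMul (n : ℤ) (f g : L2 E) :
    ⟪fourierMul n f, fourierMul n g⟫_ℂ = ⟪f, g⟫_ℂ := by
  rw [inner_fourierMul_left, fourierMul_fourierMul, neg_add_cancel, fourierMul_zero]

theorem norm_fourierMul_apply (n : ℤ) (f : L2 E) : ‖fourierMul n f‖ = ‖f‖ := by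
  rw [@norm_eq_sqrt_re_inner ℂ, inner_fourierMul_fourierMul, ← @norm_eq_sqrt_re_inner ℂ]

theorem laurent_fourierMul {Φ : Torus → E →L[ℂ] E} (hΦ : IsLInfty Φ) (n : ℤ) (f : L2 E) :
    laurent Φ hΦ (fourierMul n f) = fourierMul n (laurent Φ hΦ f) := by
  refine Lp.ext ?_
  filter_upwards [fourierMul_coeFn n f, fourierMul_coeFn n (laurent Φ hΦ f),
    laurent_coeFn Φ hΦ f, laurent_coeFn Φ hΦ (fourierMul n f)] with θ h1 h2 h3 h4
  rw [h4, h1, h2, h3, map_smul]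

theorem fourierCoeff_fourierMul (m n : ℤ) (f : L2 E) :
    fourierCoeff (fourierMul m f : Torus → E) n = fourierCoeff (f : Torus → E) (n - m) := by
  refine integral_congr_ae ?_
  filter_upwards [fourierMul_coeFn m f] with θ h
  rw [h, smul_smul, ← fourier_add, neg_sub, sub_eq_neg_add]

theorem fourierMul_mem_hardy {n : ℤ} (hn : 0 ≤ n) {f : L2 E} (hf : f ∈ hardy E) :
    fourierMul n f ∈ hardy E := fun k hk => by
  rw [fourierCoeff_fourierMul]
  exact hf _ (by omega)

/-! ### Indicators and monomials -/

/-- The embedding `η ↦ 1_s η` of `E` into `L²_E(𝕋)`. -/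
def indicatorL2 (s : Set Torus) (hs : MeasurableSet s) : E →L[ℂ] L2 E :=
  LinearMap.mkContinuous
    { toFun := fun η => indicatorConstLp 2 hs (measure_ne_top normMeasure s) η
      map_add' := fun _ _ => indicatorConstLp_add.symm
      map_smul' := fun c η => by
        refine Lp.ext ?_
        filter_upwards [Lp.coeFn_smul c
            (indicatorConstLp 2 hs (measure_ne_top normMeasure s) η),
          indicatorConstLp_coeFn (p := 2) (hs := hs) (hμs := measure_ne_top normMeasure s)
            (c := η),
          indicatorConstLp_coeFn (p := 2) (hs := hs) (hμs := measure_ne_top normMeasure s)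
            (c := c • η)] with θ h1 h2 h3
        rw [RingHom.id_apply, h1, h3, Pi.smul_apply, h2]
        by_cases h : θ ∈ s <;> simp [h] }
    √(normMeasure.real s)
    fun η => by
      refine (norm_indicatorConstLp_le (p := 2) (hs := hs)
        (hμs := measure_ne_top normMeasure s) (c := η)).trans_eq ?_
      rw [Real.sqrt_eq_rpow, mul_comm]
      norm_num

theorem indicatorL2_coeFn (s : Set Torus) (hs : MeasurableSet s) (η : E) :
    (indicatorL2 s hs η : Torus → E) =ᵐ[normMeasure] s.indicator fun _ => η :=
  indicatorConstLp_coeFn (p := 2) (hs := hs) (hμs := measure_ne_top normMeasure s) (c := η)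

theorem norm_indicatorL2_le (s : Set Torus) (hs : MeasurableSet s) :
    ‖(indicatorL2 s hs : E →L[ℂ] L2 E)‖ ≤ √(normMeasure.real s) :=
  LinearMap.mkContinuous_norm_le _ (Real.sqrt_nonneg _) _

theorem inner_indicatorL2_left (s : Set Torus) (hs : MeasurableSet s) (η : E) (f : L2 E) :
    ⟪indicatorL2 s hs η, f⟫_ℂ = ∫ θ in s, ⟪η, f θ⟫_ℂ ∂normMeasure :=
  L2.inner_indicatorConstLp_eq_setIntegral_inner ℂ f hs η (measure_ne_top _ _)

/-- The function `θ ↦ e^{inθ} η`. -/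
def monomial (n : ℤ) (η : E) : L2 E := fourierMul n (indicatorL2 Set.univ .univ η)

theorem monomial_coeFn (n : ℤ) (η : E) :
    (monomial n η : Torus → E) =ᵐ[normMeasure] fun θ => fourier n θ • η := by
  filter_upwards [fourierMul_coeFn n (indicatorL2 Set.univ .univ η),
    indicatorL2_coeFn Set.univ .univ η] with θ h1 h2
  rw [monomial, h1, h2, Set.indicator_univ]

theorem fourierMul_monomial (m n : ℤ) (η : E) :
    fourierMul m (monomial n η) = monomial (m + n) η :=
  fourierMul_fourierMul _ _ _

theorem inner_monomial_left [CompleteSpace E] (n : ℤ) (η : E) (f : L2 E) :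
    ⟪monomial n η, f⟫_ℂ = ⟪η, fourierCoeff (f : Torus → E) n⟫_ℂ := by
  rw [fourierCoeff, ← integral_inner (integrable_fourier_smul _ f), L2.inner_def]
  refine integral_congr_ae ?_
  filter_upwards [monomial_coeFn n η] with θ h
  rw [h, inner_smul_left, inner_smul_right, fourier_neg]

theorem fourierCoeff_monomial_of_ne [CompleteSpace E] {m n : ℤ} (h : n ≠ m) (η : E) :
    fourierCoeff (monomial m η : Torus → E) n = 0 := by
  have h1 : fourierCoeff (monomial m η : Torus → E) n
      = ∫ θ : Torus, fourier (-n + m) θ • η ∂normMeasure := by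
    refine integral_congr_ae ?_
    filter_upwards [monomial_coeFn m η] with θ h
    rw [h, smul_smul, fourier_add]
  have h2 := fourierCoeff_fourier (T := 2 * Real.pi) m
  have h3 := congrFun h2 n
  rw [Pi.single_eq_of_ne h, fourierCoeff] at h3
  rw [h1, integral_smul_const]
  simp_rw [fourier_add]
  simp_rw [smul_eq_mul] at h3
  rw [h3, zero_smul]

theorem monomial_mem_hardy [CompleteSpace E] {n : ℤ} (hn : 0 ≤ n) (η : E) :
    monomial n η ∈ hardy E := fun k hk => fourierCoeff_monomial_of_ne (by omega) η

theorem ae_eq_zero_of_fourierCoeff_eq_zero {f : Torus → ℂ} (hf : MemLp f 2 normMeasure)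
    (h : ∀ n, fourierCoeff f n = 0) : f =ᵐ[normMeasure] 0 := by
  have h0 : hf.toLp f = 0 := by
    refine (fourierBasis (T := 2 * Real.pi)).repr.injective ?_
    ext n
    rw [fourierBasis_repr, map_zero, fourierCoeff_congr_ae hf.coeFn_toLp, h]
    rfl
  exact hf.coeFn_toLp.symm.trans (by rw [h0]; exact Lp.coeFn_zero _ _ _)

theorem eq_zero_of_inner_monomial [CompleteSpace E] {f : L2 E}
    (h : ∀ n η, ⟪monomial n η, f⟫_ℂ = 0) : f = 0 := by
  have hcoef (n : ℤ) : fourierCoeff (f : Torus → E) n = 0 := by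
    rw [← inner_self_eq_zero (𝕜 := ℂ), ← inner_monomial_left]
    exact h n _
  have hi : Integrable (f : Torus → E) normMeasure := (Lp.memLp f).integrable (by norm_num)
  have hη (η : E) : (fun θ => ⟪η, f θ⟫_ℂ) =ᵐ[normMeasure] 0 := by
    refine ae_eq_zero_of_fourierCoeff_eq_zero ((Lp.memLp f).const_inner η) fun n => ?_
    have h1 := h n η
    rw [inner_monomial_left, fourierCoeff, ← integral_inner (integrable_fourier_smul _ f)] at h1
    simpa only [fourierCoeff, inner_smul_right, smul_eq_mul] using h1
  refine Lp.ext (EventuallyEq.trans ?_ (Lp.coeFn_zero E 2 normMeasure).symm)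
  -- The null set in `hη` depends on `η`. Integrating over a set first leaves a single vector
  -- orthogonal to every `η`.
  refine hi.ae_eq_zero_of_forall_setIntegral_eq_zero fun s hs _ => ?_
  rw [← inner_self_eq_zero (𝕜 := ℂ), ← integral_inner hi.integrableOn]
  exact (integral_congr_ae (ae_restrict_of_ae (hη _))).trans (by simp)

theorem ext_inner_monomial [CompleteSpace E] {f g : L2 E}
    (h : ∀ n η, ⟪monomial n η, f⟫_ℂ = ⟪monomial n η, g⟫_ℂ) : f = g :=
  sub_eq_zero.mp <| eq_zero_of_inner_monomial fun n η => by rw [inner_sub_right, h, sub_self]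

/-- Passing to adjoints reduces this to testing vectors against monomials, so no density argument is
needed. -/
theorem ext_monomial [CompleteSpace E] {A B : L2 E →L[ℂ] L2 E}
    (h : ∀ n η, A (monomial n η) = B (monomial n η)) : A = B := by
  have h' : ContinuousLinearMap.adjoint A = ContinuousLinearMap.adjoint B := by
    ext1 f
    refine ext_inner_monomial fun n η => ?_
    rw [ContinuousLinearMap.adjoint_inner_right, ContinuousLinearMap.adjoint_inner_right, h]
  exact ContinuousLinearMap.adjoint.injective h'

/-- Doubling is unaffected by rescaling the measure; it is what permits Lebesgue differentiation
along balls. -/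
instance isUnifLocDoublingMeasure_normMeasure : IsUnifLocDoublingMeasure normMeasure := by
  obtain ⟨C, hC⟩ := IsUnifLocDoublingMeasure.exists_measure_closedBall_le_mul''
    (μ := (volume : Measure Torus))
  refine ⟨⟨C, ?_⟩⟩
  filter_upwards [hC] with ε hε x
  have h := hε x
  rw [volume_eq_smul_haarAddCircle, Measure.smul_apply, Measure.smul_apply, smul_eq_mul,
    smul_eq_mul, mul_left_comm] at h
  exact (ENNReal.mul_le_mul_iff_right (by simp [Real.pi_pos]) ENNReal.ofReal_ne_top).mp h

theorem fourierMul_comm_of_fourierMul_one_comm {A : L2 E →L[ℂ] L2 E}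
    (hA : ∀ f, A (fourierMul 1 f) = fourierMul 1 (A f)) (n : ℤ) (f : L2 E) :
    A (fourierMul n f) = fourierMul n (A f) := by
  have hA' (f : L2 E) : A (fourierMul (-1) f) = fourierMul (-1) (A f) := by
    have h := hA (fourierMul (-1) f)
    rw [fourierMul_fourierMul, add_neg_cancel, fourierMul_zero] at h
    rw [h, fourierMul_fourierMul, neg_add_cancel, fourierMul_zero]
  induction n generalizing f with
  | zero => rw [fourierMul_zero, fourierMul_zero]
  | succ n ih => rw [← fourierMul_fourierMul, ih, hA, fourierMul_fourierMul]
  | pred n ih =>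
    rw [sub_eq_add_neg, ← fourierMul_fourierMul, ih, hA', fourierMul_fourierMul]

/-! ### Operators commuting with `z` are Laurent operators -/

variable [CompleteSpace E]

/-- If `A = M_Φ`, both sides are `⟪ξ, Φ(θ) η⟫`. Without a symbol at hand, the commutation shows that
their Fourier coefficients agree. -/
theorem inner_adjoint_monomial_ae_eq {A : L2 E →L[ℂ] L2 E}
    (hA : ∀ n f, A (fourierMul n f) = fourierMul n (A f))
    (ξ η : E) :
    (fun θ => ⟪ξ, A (monomial 0 η) θ⟫_ℂ) =ᵐ[normMeasure]
      fun θ => ⟪ContinuousLinearMap.adjoint A (monomial 0 ξ) θ, η⟫_ℂ := by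
  set g := ContinuousLinearMap.adjoint A (monomial 0 ξ) with hg
  have m1 : MemLp (fun θ => ⟪ξ, A (monomial 0 η) θ⟫_ℂ) 2 normMeasure :=
    (Lp.memLp (A (monomial 0 η))).const_inner ξ
  have m2 : MemLp (fun θ => ⟪g θ, η⟫_ℂ) 2 normMeasure := (Lp.memLp g).inner_const η
  rw [← sub_ae_eq_zero]
  refine ae_eq_zero_of_fourierCoeff_eq_zero (m1.sub m2) fun n => ?_
  have e1 : fourierCoeff (fun θ => ⟪ξ, A (monomial 0 η) θ⟫_ℂ) n
      = ⟪monomial n ξ, A (monomial 0 η)⟫_ℂ := by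
    rw [fourierCoeff, L2.inner_def]
    refine integral_congr_ae ?_
    filter_upwards [monomial_coeFn n ξ] with θ h
    rw [h, inner_smul_left, smul_eq_mul, fourier_neg]
  have e2 : fourierCoeff (fun θ => ⟪g θ, η⟫_ℂ) n = ⟪fourierMul n g, monomial 0 η⟫_ℂ := by
    rw [fourierCoeff, L2.inner_def]
    refine integral_congr_ae ?_
    filter_upwards [monomial_coeFn 0 η, fourierMul_coeFn n g] with θ h1 h2
    rw [h1, h2, inner_smul_left, smul_eq_mul, fourier_neg, fourier_zero, one_smul]
  have e3 : ⟪fourierMul n g, monomial 0 η⟫_ℂ = ⟪monomial n ξ, A (monomial 0 η)⟫_ℂ := by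
    rw [inner_fourierMul_left, hg, ContinuousLinearMap.adjoint_inner_left, hA,
      ← inner_fourierMul_left, fourierMul_monomial, add_zero]
  have i1 := (m1.integrable (by norm_num)).fourier_smul (-n)
  have i2 := (m2.integrable (by norm_num)).fourier_smul (-n)
  have e4 : fourierCoeff ((fun θ => ⟪ξ, A (monomial 0 η) θ⟫_ℂ) - fun θ => ⟪g θ, η⟫_ℂ) n
      = fourierCoeff (fun θ => ⟪ξ, A (monomial 0 η) θ⟫_ℂ) n
        - fourierCoeff (fun θ => ⟪g θ, η⟫_ℂ) n := by
    rw [fourierCoeff, fourierCoeff, fourierCoeff, ← integral_sub i1 i2]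
    simp only [Pi.sub_apply, smul_sub]
  rw [e4, e1, e2, e3, sub_self]

/-- An operator commuting with multiplication by `z` commutes with multiplication by indicator
functions. -/
theorem apply_indicatorL2_ae_eq {A : L2 E →L[ℂ] L2 E}
    (hA : ∀ n f, A (fourierMul n f) = fourierMul n (A f))
    (s : Set Torus) (hs : MeasurableSet s) (η : E) :
    (A (indicatorL2 s hs η) : Torus → E) =ᵐ[normMeasure] s.indicator (A (monomial 0 η)) := by
  have hm := (Lp.memLp (A (monomial 0 η))).indicator hs
  suffices h : A (indicatorL2 s hs η) = hm.toLp _ by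
    rw [h]
    exact hm.coeFn_toLp
  refine ext_inner_monomial fun n ξ => ?_
  -- Moving `A` to the other side frees the indicator, so the pointwise adjoint identity applies
  -- without approximating it by trigonometric polynomials.
  have e : ⟪monomial n ξ, A (indicatorL2 s hs η)⟫_ℂ
      = ⟪ContinuousLinearMap.adjoint A (monomial 0 ξ), fourierMul (-n) (indicatorL2 s hs η)⟫_ℂ := by
    rw [ContinuousLinearMap.adjoint_inner_left, hA, ← inner_fourierMul_left,
      fourierMul_monomial, add_zero]
  rw [e, L2.inner_def, L2.inner_def]
  refine integral_congr_ae ?_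
  filter_upwards [inner_adjoint_monomial_ae_eq hA ξ η, hm.coeFn_toLp, monomial_coeFn n ξ,
    fourierMul_coeFn (-n) (indicatorL2 s hs η), indicatorL2_coeFn s hs η] with θ h1 h2 h3 h4 h5
  rw [h2, h3, h4, h5, inner_smul_left, inner_smul_right, fourier_neg]
  by_cases h : θ ∈ s
  · rw [Set.indicator_of_mem h, Set.indicator_of_mem h, h1]
  · rw [Set.indicator_of_notMem h, Set.indicator_of_notMem h, inner_zero_right, inner_zero_right]

/-- The two embeddings contribute at most the measure of `s`, which the normalization cancels; for a
null set the inverse is zero. -/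
theorem norm_compression_le (A : L2 E →L[ℂ] L2 E) (s : Set Torus) (hs : MeasurableSet s) :
    ‖((normMeasure.real s)⁻¹ : ℂ) • (ContinuousLinearMap.adjoint (indicatorL2 s hs) ∘L A ∘L
      indicatorL2 (E := E) s hs)‖ ≤ ‖A‖ := by
  set J : E →L[ℂ] L2 E := indicatorL2 s hs
  set m := normMeasure.real s
  have hm : 0 ≤ m := measureReal_nonneg
  have hJ : ‖J‖ ≤ √m := norm_indicatorL2_le s hs
  have h1 : ‖ContinuousLinearMap.adjoint J ∘L A ∘L J‖ ≤ √m * (‖A‖ * √m) := by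
    refine (ContinuousLinearMap.opNorm_comp_le _ _).trans ?_
    rw [LinearIsometryEquiv.norm_map]
    refine mul_le_mul hJ ?_ (norm_nonneg _) (Real.sqrt_nonneg _)
    exact (ContinuousLinearMap.opNorm_comp_le _ _).trans
      (mul_le_mul_of_nonneg_left hJ (norm_nonneg _))
  have h2 : √m * (‖A‖ * √m) = m * ‖A‖ := by
    rw [mul_left_comm, Real.mul_self_sqrt hm, mul_comm]
  rw [h2] at h1
  rw [norm_smul, norm_inv, Complex.norm_real, Real.norm_of_nonneg hm]
  calc m⁻¹ * _ ≤ m⁻¹ * (m * ‖A‖) := mul_le_mul_of_nonneg_left h1 (inv_nonneg.mpr hm)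
    _ = (m⁻¹ * m) * ‖A‖ := (mul_assoc _ _ _).symm
    _ ≤ 1 * ‖A‖ := mul_le_mul_of_nonneg_right inv_mul_le_one (norm_nonneg _)
    _ = ‖A‖ := one_mul _

/-- Since `A` respects indicators, its compression to `s` has averages over `s` as matrix entries,
ready for differentiation. -/
theorem inner_compression {A : L2 E →L[ℂ] L2 E}
    (hA : ∀ n f, A (fourierMul n f) = fourierMul n (A f))
    (s : Set Torus) (hs : MeasurableSet s) (ξ η : E) :
    ⟪ξ, (((normMeasure.real s)⁻¹ : ℂ) • (ContinuousLinearMap.adjoint (indicatorL2 s hs) ∘L A ∘L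
      indicatorL2 (E := E) s hs)) η⟫_ℂ = ⟪ξ, ⨍ θ in s, A (monomial 0 η) θ ∂normMeasure⟫_ℂ := by
  have hi : Integrable (A (monomial 0 η) : Torus → E) normMeasure :=
    (Lp.memLp _).integrable (by norm_num)
  rw [_root_.smul_apply, inner_smul_right, ContinuousLinearMap.comp_apply,
    ContinuousLinearMap.adjoint_inner_right, ContinuousLinearMap.comp_apply,
    inner_indicatorL2_left, setAverage_eq, inner_smul_right_eq_smul,
    ← integral_inner hi.integrableOn]
  have h : ∫ θ in s, ⟪ξ, A (indicatorL2 s hs η) θ⟫_ℂ ∂normMeasure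
      = ∫ θ in s, ⟪ξ, A (monomial 0 η) θ⟫_ℂ ∂normMeasure := by
    refine setIntegral_congr_ae hs ?_
    filter_upwards [apply_indicatorL2_ae_eq hA s hs η] with θ h hθ
    rw [h, Set.indicator_of_mem hθ]
  rw [h, Complex.real_smul, Complex.ofReal_inv]

/-- A bounded operator on `L²_E(𝕋)` commuting with multiplication by `z` is a Laurent operator. -/
theorem exists_laurent_eq {A : L2 E →L[ℂ] L2 E}
    (hA : ∀ n f, A (fourierMul n f) = fourierMul n (A f)) :
    ∃ (Φ : Torus → E →L[ℂ] E) (hΦ : IsLInfty Φ), A = laurent Φ hΦ := by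
  let F : Ultrafilter ℝ := Ultrafilter.of (𝓝[>] 0)
  have hF : (F : Filter ℝ) ≤ 𝓝[>] 0 := Ultrafilter.of_le _
  choose Φ hΦn hΦt using fun θ : Torus => exists_weakOperator_lim F
    (fun r => ((normMeasure.real (Metric.closedBall θ r))⁻¹ : ℂ) •
      (ContinuousLinearMap.adjoint (indicatorL2 _ Metric.isClosed_closedBall.measurableSet) ∘L A ∘L
        indicatorL2 (E := E) (Metric.closedBall θ r) Metric.isClosed_closedBall.measurableSet))
    ‖A‖ (fun r => norm_compression_le A _ _)
  have hae (η : E) : (A (monomial 0 η) : Torus → E) =ᵐ[normMeasure] fun θ => Φ θ η := by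
    have hi : Integrable (A (monomial 0 η) : Torus → E) normMeasure :=
      (Lp.memLp _).integrable (by norm_num)
    filter_upwards [IsUnifLocDoublingMeasure.ae_tendsto_average normMeasure
      hi.locallyIntegrable 1] with θ hθ
    -- Fixed centres and dilation factor 1 suffice, as each ball is centred at `θ`.
    have h1 := hθ (fun _ => θ) id (tendsto_id'.mpr hF) (by
      filter_upwards [hF self_mem_nhdsWithin] with r hr
      exact Metric.mem_closedBall_self (by simpa using (Set.mem_Ioi.mp hr).le))
    refine ext_inner_left ℂ fun ξ => ?_
    refine tendsto_nhds_unique (tendsto_const_nhds.inner h1) ?_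
    exact (hΦt θ η ξ).congr fun r => inner_compression hA _ _ ξ η
  have hΦ : IsLInfty Φ :=
    ⟨fun η => (Lp.aestronglyMeasurable _).congr (hae η), ‖A‖, Eventually.of_forall hΦn⟩
  refine ⟨Φ, hΦ, ext_monomial fun n η => ?_⟩
  have h0 : A (monomial 0 η) = laurent Φ hΦ (monomial 0 η) := by
    refine Lp.ext ?_
    filter_upwards [hae η, laurent_coeFn Φ hΦ (monomial 0 η), monomial_coeFn 0 η] with θ h1 h2 h3
    rw [h1, h2, h3, fourier_zero, one_smul]
  rw [← add_zero n, ← fourierMul_monomial, hA, laurent_fourierMul, h0]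

/-! ### Dilation to `L²` and compression -/

/-- An operator `T` on `H²_E(𝔻)` with `T_z^* T T_z = T` is the compression of an operator on
`L²_E(𝕋)` that commutes with multiplication by `z`. -/
theorem exists_dilation {T : hardy E →L[ℂ] hardy E}
    (hT : ContinuousLinearMap.adjoint (Tz E) ∘L T ∘L Tz E = T) :
    ∃ A : L2 E →L[ℂ] L2 E, (∀ f, A (fourierMul 1 f) = fourierMul 1 (A f)) ∧
      ∀ f g : hardy E, ⟪(g : L2 E), A f⟫_ℂ = ⟪g, T f⟫_ℂ := by
  have hshift (f g : hardy E) : ⟪Tz E g, T (Tz E f)⟫_ℂ = ⟪g, T f⟫_ℂ := by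
    rw [← ContinuousLinearMap.adjoint_inner_right]
    exact congrArg (fun R : hardy E →L[ℂ] hardy E => ⟪g, R f⟫_ℂ) hT
  let S : ℕ → L2 E →L[ℂ] L2 E := fun n => fourierMul (-n) ∘L (hardy E).subtypeL ∘L T ∘L
    (hardy E).orthogonalProjectionOnto ∘L fourierMul n
  have hS (n : ℕ) : ‖S n‖ ≤ ‖T‖ := by
    refine ContinuousLinearMap.opNorm_le_bound _ (norm_nonneg T) fun f => ?_
    calc ‖S n f‖ = ‖T ((hardy E).orthogonalProjectionOnto (fourierMul n f))‖ :=
          norm_fourierMul_apply _ _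
      _ ≤ ‖T‖ * ‖(hardy E).orthogonalProjectionOnto (fourierMul n f)‖ := T.le_opNorm _
      _ ≤ ‖T‖ * ‖f‖ := by
          refine mul_le_mul_of_nonneg_left ?_ (norm_nonneg T)
          rw [← norm_fourierMul_apply n f]
          exact (hardy E).norm_orthogonalProjectionOnto_apply_le _
  -- Once `Uⁿ` carries both vectors into the Hardy space, the projection disappears.
  have hS_inner (n : ℕ) (f g : L2 E) (hf : fourierMul n f ∈ hardy E)
      (hg : fourierMul n g ∈ hardy E) :
      ⟪g, S n f⟫_ℂ = ⟪(⟨_, hg⟩ : hardy E), T ⟨_, hf⟩⟫_ℂ := by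
    have h : (hardy E).orthogonalProjectionOnto (fourierMul n f) = ⟨_, hf⟩ :=
      (hardy E).orthogonalProjectionOnto_mem_subspace_eq_self ⟨_, hf⟩
    calc ⟪g, S n f⟫_ℂ = ⟪g, fourierMul (-n)
          (T ((hardy E).orthogonalProjectionOnto (fourierMul n f)) : L2 E)⟫_ℂ := rfl
      _ = _ := by rw [← inner_fourierMul_left, h, Submodule.coe_inner]
  have hS_hardy (n : ℕ) (f g : hardy E) : ⟪(g : L2 E), S n f⟫_ℂ = ⟪g, T f⟫_ℂ := by
    rw [hS_inner n f g (fourierMul_mem_hardy (by omega) f.2)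
      (fourierMul_mem_hardy (by omega) g.2)]
    induction n generalizing f g with
    | zero => simp only [Nat.cast_zero, fourierMul_zero]
    | succ n ih =>
      rw [← hshift f g, ← ih (Tz E f) (Tz E g)]
      simp only [coe_Tz_apply, fourierMul_fourierMul, Nat.cast_succ]
  let F : Ultrafilter ℕ := Ultrafilter.of atTop
  have hF : (F : Filter ℕ) ≤ atTop := Ultrafilter.of_le _
  obtain ⟨A, -, hA⟩ := exists_weakOperator_lim F S ‖T‖ hS
  refine ⟨A, fun f => ?_, fun f g => ?_⟩
  · suffices h : A ∘L fourierMul 1 = fourierMul 1 ∘L A from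
      congrArg (fun R : L2 E →L[ℂ] L2 E => R f) h
    refine ext_monomial fun i η => ext_inner_monomial fun j ξ => ?_
    have hr : ⟪monomial j ξ, fourierMul 1 (A (monomial i η))⟫_ℂ
        = ⟪monomial (-1 + j) ξ, A (monomial i η)⟫_ℂ := by
      rw [← fourierMul_monomial, inner_fourierMul_left, neg_neg]
    rw [ContinuousLinearMap.comp_apply, ContinuousLinearMap.comp_apply, hr, fourierMul_monomial]
    refine tendsto_nhds_unique (hA _ _) ((hA _ _).congr' ?_)
    -- The extra 1 covers the exponents `1 + i` and `-1 + j`; beyond this threshold all four shifted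
    -- monomials lie in the Hardy space, and one use of `hshift` matches the two sides.
    filter_upwards [hF (eventually_ge_atTop (i.natAbs + j.natAbs + 1))] with n hn
    have hf : fourierMul n (monomial i η) ∈ hardy E := by
      rw [fourierMul_monomial]; exact monomial_mem_hardy (by omega) η
    have hg : fourierMul n (monomial (-1 + j) ξ) ∈ hardy E := by
      rw [fourierMul_monomial]; exact monomial_mem_hardy (by omega) ξ
    have hf' : fourierMul n (monomial (1 + i) η) ∈ hardy E := by
      rw [fourierMul_monomial]; exact monomial_mem_hardy (by omega) η
    have hg' : fourierMul n (monomial j ξ) ∈ hardy E := by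
      rw [fourierMul_monomial]; exact monomial_mem_hardy (by omega) ξ
    rw [hS_inner n _ _ hf hg, hS_inner n _ _ hf' hg', ← hshift]
    have e1 : Tz E ⟨_, hf⟩ = ⟨_, hf'⟩ := Subtype.ext (by
      rw [coe_Tz_apply]
      simp only [fourierMul_monomial]
      congr 1; ring)
    have e2 : Tz E ⟨_, hg⟩ = ⟨_, hg'⟩ := Subtype.ext (by
      rw [coe_Tz_apply]
      simp only [fourierMul_monomial]
      congr 1; ring)
    rw [e1, e2]
  · exact tendsto_nhds_unique (hA _ _) (tendsto_const_nhds.congr fun n => (hS_hardy n f g).symm)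

theorem inner_compression_hardy (B : L2 E →L[ℂ] L2 E) (f g : hardy E) :
    ⟪g, ((hardy E).orthogonalProjectionOnto ∘L B ∘L (hardy E).subtypeL) f⟫_ℂ
      = ⟪(g : L2 E), B f⟫_ℂ :=
  Submodule.inner_orthogonalProjectionOnto_eq_of_mem_left g (B f)

end HardyToeplitz
end

theorem theorem5p2 {E : Type*} [NormedAddCommGroup E] [InnerProductSpace ℂ E] [CompleteSpace E]
    (T : HardyToeplitz.hardy E →L[ℂ] HardyToeplitz.hardy E) :
    HardyToeplitz.IsToeplitz T ↔
      ContinuousLinearMap.adjoint (HardyToeplitz.Tz E) ∘L T ∘L HardyToeplitz.Tz E = T := by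
  open HardyToeplitz in
  constructor
  · rintro ⟨Φ, hΦ, rfl⟩
    ext1 f
    refine ext_inner_left ℂ fun g => ?_
    rw [ContinuousLinearMap.comp_apply, ContinuousLinearMap.adjoint_inner_right,
      ContinuousLinearMap.comp_apply, inner_compression_hardy, inner_compression_hardy,
      coe_Tz_apply, coe_Tz_apply, laurent_fourierMul, inner_fourierMul_fourierMul]
  · intro hT
    obtain ⟨A, hA, hAT⟩ := exists_dilation hT
    obtain ⟨Φ, hΦ, rfl⟩ := exists_laurent_eq (fourierMul_comm_of_fourierMul_one_comm hA)
    refine ⟨Φ, hΦ, ?_⟩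
    ext1 f
    refine ext_inner_left ℂ fun g => ?_
    rw [inner_compression_hardy, hAT]
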